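/- Let $n\ge 3$ and $d\ge 2$, and let $\lambda_1,\dots,\lambda_{d^2-1}$ be generators of $SU(d)$, that is, complex $d\times d$ matrices with $\lambda_i^\dagger=\lambda_i$, $\operatorname{Tr}(\lambda_i)=0$ and $\operatorname{Tr}(\lambda_i\lambda_j)=2\delta_{ij}$. Let $\rho$ be an $n$-qudit quantum state, i.e. a positive semidefinite operator of trace one on $(\mathbb C^d)^{\otimes n}$ (pure or mixed), and let $\mathbf T^{(12\cdots n)}$ be the real tensor with entries $$t_{i_1\cdots i_n}=\operatorname{Tr}\bigl(\rho\,\lambda_{i_1}\otimes\lambda_{i_2}\otimes\cdots\otimes\lambda_{i_n}\bigr),\qquad 1\le i_1,\dots,i_n\le d^2-1,$$ with Euclidean norm $\|\mathbf T^{(12\cdots n)}\|^2=\sum_{i_1,\dots,i_n=1}^{d^2-1} t_{i_1\cdots i_n}^2$. Then $$\bigl\|\mathbf T^{(12\cdots n)}\bigr\|^2\le\frac{2^n\left[(n-2)d^n-n\,d^{n-2}+2\right]}{(n-2)\,d^n}.$$ -/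

import Mathlib

open scoped ComplexOrder

/-- A density matrix (quantum state): positive semidefinite with trace one. -/
structure IsDensityMatrix {ι : Type*} [Fintype ι] (ρ : Matrix ι ι ℂ) : Prop where
  posSemidef : ρ.PosSemidef
  trace_eq_one : ρ.trace = 1

/-- A system of generators of `SU(d)`: `d ^ 2 - 1` Hermitian traceless `d × d` matrices
with `Tr (lam i * lam j) = 2 δ_ij`. -/
structure IsSUGenerators (d : ℕ) (lam : Fin (d ^ 2 - 1) → Matrix (Fin d) (Fin d) ℂ) :
    Prop where
  isHermitian : ∀ i, (lam i).IsHermitian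
  trace_eq_zero : ∀ i, (lam i).trace = 0
  trace_mul : ∀ i j, (lam i * lam j).trace = if i = j then 2 else 0

/-- The Kronecker product `A 0 ⊗ A 1 ⊗ ⋯ ⊗ A (n - 1)` of `d × d` matrices, as a matrix on
`(ℂ^d)^{⊗ n}` in the product basis, which is indexed by `Fin n → Fin d`. -/
def tensorMatrix {n d : ℕ} (A : Fin n → Matrix (Fin d) (Fin d) ℂ) :
    Matrix (Fin n → Fin d) (Fin n → Fin d) ℂ :=
  Matrix.of fun x y => ∏ k, A k (x k) (y k)

/-- The correlation tensor `T^{(12⋯n)}` of `ρ`, with the entries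
`t_{i 1 ⋯ i n} = Tr (ρ (lam (i 1) ⊗ ⋯ ⊗ lam (i n)))`, and with the Euclidean norm. The trace is
a real number when `ρ` and the `lam i` are Hermitian, see `ofReal_blochTensor`. -/
noncomputable def blochTensor {n d : ℕ} (lam : Fin (d ^ 2 - 1) → Matrix (Fin d) (Fin d) ℂ)
    (ρ : Matrix (Fin n → Fin d) (Fin n → Fin d) ℂ) :
    EuclideanSpace ℝ (Fin n → Fin (d ^ 2 - 1)) :=
  WithLp.toLp 2 fun i => ((ρ * tensorMatrix fun k => lam (i k)).trace).re

theorem tensorMatrix_isHermitian {n d : ℕ} {A : Fin n → Matrix (Fin d) (Fin d) ℂ}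
    (hA : ∀ k, (A k).IsHermitian) : (tensorMatrix A).IsHermitian := by
  ext x y
  simp only [tensorMatrix, Matrix.conjTranspose_apply, Matrix.of_apply, star_prod]
  exact Finset.prod_congr rfl fun k _ => (hA k).apply _ _

/-- The entries of the correlation tensor of a state are the traces themselves. -/
theorem ofReal_blochTensor {n d : ℕ} {lam : Fin (d ^ 2 - 1) → Matrix (Fin d) (Fin d) ℂ}
    (hlam : IsSUGenerators d lam) {ρ : Matrix (Fin n → Fin d) (Fin n → Fin d) ℂ}
    (hρ : IsDensityMatrix ρ) (i : Fin n → Fin (d ^ 2 - 1)) :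
    ((blochTensor lam ρ i : ℝ) : ℂ) = (ρ * tensorMatrix fun k => lam (i k)).trace := by
  have h1 : (tensorMatrix fun k => lam (i k)).IsHermitian :=
    tensorMatrix_isHermitian fun k => hlam.isHermitian (i k)
  have h2 : star (ρ * tensorMatrix fun k => lam (i k)).trace
      = (ρ * tensorMatrix fun k => lam (i k)).trace := by
    rw [← Matrix.trace_conjTranspose, Matrix.conjTranspose_mul, h1.eq,
      hρ.posSemidef.isHermitian.eq, Matrix.trace_mul_comm]
  exact Complex.conj_eq_iff_re.mp h2

open Matrix Finset

/-! Expand `ρ` in products of the orthogonal basis formed by `1` and the `lam i`. The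
`sectorWeight`s are nonnegative, and those supported on `S` sum to `Tr(ρ_S²) / d ^ #Sᶜ`. For pure
states `Tr(ρ_S²) = Tr(ρ_{Sᶜ}²)` (`pow_mul_supportWeight_compl`); taking `S = univ` and `S = {i}`
gives linear relations between the weights. Averaging the pointwise inequality `support_count_le`
against the weights turns these relations into the bound on the full-support part, which is the norm
up to `2 ^ n`. Mixed states follow from the triangle inequality. -/

/-! ### Orthogonality and completeness of the one-site basis. -/

/-- The generators of `SU(d)` completed by the identity, at index `none`. -/
def matrixBasis {d : ℕ} (lam : Fin (d ^ 2 - 1) → Matrix (Fin d) (Fin d) ℂ) :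
    Option (Fin (d ^ 2 - 1)) → Matrix (Fin d) (Fin d) ℂ
  | none => 1
  | some i => lam i

/-- The inverse squared Hilbert-Schmidt norms of the elements of `matrixBasis`. -/
noncomputable def basisWeight (d : ℕ) : Option (Fin (d ^ 2 - 1)) → ℝ
  | none => (d : ℝ)⁻¹
  | some _ => 2⁻¹

theorem basisWeight_nonneg (d : ℕ) (a : Option (Fin (d ^ 2 - 1))) : 0 ≤ basisWeight d a := by
  cases a <;> simp [basisWeight]

theorem matrixBasis_isHermitian {d : ℕ} {lam : Fin (d ^ 2 - 1) → Matrix (Fin d) (Fin d) ℂ}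
    (hlam : IsSUGenerators d lam) (a : Option (Fin (d ^ 2 - 1))) :
    (matrixBasis lam a).IsHermitian := by
  cases a with
  | none => exact Matrix.isHermitian_one
  | some i => exact hlam.isHermitian i

theorem basisWeight_mul_trace {d : ℕ} (hd : 2 ≤ d)
    {lam : Fin (d ^ 2 - 1) → Matrix (Fin d) (Fin d) ℂ}
    (hlam : IsSUGenerators d lam) (a b : Option (Fin (d ^ 2 - 1))) :
    (basisWeight d a : ℂ) * (matrixBasis lam a * matrixBasis lam b).trace
      = if a = b then 1 else 0 := by
  have hd0 : (d : ℂ) ≠ 0 := by norm_cast; omega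
  cases a <;> cases b <;>
    simp [matrixBasis, basisWeight, hlam.trace_eq_zero, hlam.trace_mul, hd0]

/-- The weighted completeness relation: the sum of `B a ⊗ B a` over the basis is the swap. -/
theorem sum_basisWeight_mul {d : ℕ} (hd : 2 ≤ d)
    {lam : Fin (d ^ 2 - 1) → Matrix (Fin d) (Fin d) ℂ} (hlam : IsSUGenerators d lam)
    (x y z w : Fin d) :
    ∑ a, (basisWeight d a : ℂ) * (matrixBasis lam a x y * matrixBasis lam a z w)
      = if x = w ∧ y = z then 1 else 0 := by
  let U : Matrix (Option (Fin (d ^ 2 - 1))) (Fin d × Fin d) ℂ :=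
    Matrix.of fun a p => basisWeight d a * matrixBasis lam a p.1 p.2
  let V : Matrix (Fin d × Fin d) (Option (Fin (d ^ 2 - 1))) ℂ :=
    Matrix.of fun p a => matrixBasis lam a p.2 p.1
  -- Orthogonality says `U * V = 1`; completeness is `V * U = 1`, which follows because both index
  -- types have `d ^ 2` elements.
  have hUV : U * V = 1 := by
    ext a b
    rw [Matrix.one_apply, ← basisWeight_mul_trace hd hlam a b, Matrix.mul_apply,
      Fintype.sum_prod_type, Matrix.trace, Finset.mul_sum]
    refine Finset.sum_congr rfl fun x _ => ?_
    simp only [Matrix.diag, Matrix.mul_apply, Finset.mul_sum, U, V, Matrix.of_apply, mul_assoc]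
  have hcard : Fintype.card (Option (Fin (d ^ 2 - 1))) = Fintype.card (Fin d × Fin d) := by
    have : 0 < d ^ 2 := by positivity
    simp only [Fintype.card_option, Fintype.card_fin, Fintype.card_prod]
    rw [Nat.sub_add_cancel this, sq]
  have hVU : V * U = 1 := (Matrix.mul_eq_one_comm_of_card_eq _ _ _ hcard).mp hUV
  have h := congrFun (congrFun hVU (y, x)) (z, w)
  rw [Matrix.mul_apply, Matrix.one_apply] at h
  simp only [U, V, Matrix.of_apply, Prod.mk.injEq] at h
  simp only [and_comm (a := x = w)]
  rw [← h]
  exact Finset.sum_congr rfl fun a _ => by ring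

/-! ### Weights of the expansion and purities of subsystems. -/

/-- The squared coefficient of `ρ` along a product of basis elements, suitably normalized. -/
noncomputable def sectorWeight {n d : ℕ} (lam : Fin (d ^ 2 - 1) → Matrix (Fin d) (Fin d) ℂ)
    (ρ : Matrix (Fin n → Fin d) (Fin n → Fin d) ℂ) (j : Fin n → Option (Fin (d ^ 2 - 1))) : ℝ :=
  (∏ k, basisWeight d (j k)) * ((ρ * tensorMatrix fun k => matrixBasis lam (j k)).trace).re ^ 2

theorem sectorWeight_nonneg {n d : ℕ} (lam : Fin (d ^ 2 - 1) → Matrix (Fin d) (Fin d) ℂ)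
    (ρ : Matrix (Fin n → Fin d) (Fin n → Fin d) ℂ) (j : Fin n → Option (Fin (d ^ 2 - 1))) :
    0 ≤ sectorWeight lam ρ j :=
  mul_nonneg (Finset.prod_nonneg fun _ _ => basisWeight_nonneg _ _) (sq_nonneg _)

theorem ofReal_re_trace_mul {ι : Type*} [Fintype ι] {A B : Matrix ι ι ℂ}
    (hA : A.IsHermitian) (hB : B.IsHermitian) : (((A * B).trace.re : ℝ) : ℂ) = (A * B).trace := by
  have h : star (A * B).trace = (A * B).trace := by
    rw [← Matrix.trace_conjTranspose, Matrix.conjTranspose_mul, hA.eq, hB.eq,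
      Matrix.trace_mul_comm]
  exact Complex.conj_eq_iff_re.mp h

/-- The total weight of the sectors supported on `S`. -/
noncomputable def supportWeight {n d : ℕ} (lam : Fin (d ^ 2 - 1) → Matrix (Fin d) (Fin d) ℂ)
    (ρ : Matrix (Fin n → Fin d) (Fin n → Fin d) ℂ) (S : Finset (Fin n)) : ℝ :=
  ∑ j ∈ Fintype.piFinset fun k => if k ∈ S then univ else {none}, sectorWeight lam ρ j

/-- The weight supported on `S` as a contraction of `ρ ⊗ ρ` with swaps on `S` and identities on
the complement. -/
theorem supportWeight_eq_sum {n d : ℕ} (hd : 2 ≤ d)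
    {lam : Fin (d ^ 2 - 1) → Matrix (Fin d) (Fin d) ℂ} (hlam : IsSUGenerators d lam)
    {ρ : Matrix (Fin n → Fin d) (Fin n → Fin d) ℂ} (hρ : ρ.IsHermitian) (S : Finset (Fin n)) :
    (d : ℂ) ^ (#Sᶜ) * (supportWeight lam ρ S : ℂ) =
      ∑ x, ∑ y, ∑ z, ∑ w, ρ y x * ρ w z *
        ∏ k, if k ∈ S then (if x k = w k ∧ y k = z k then 1 else 0)
          else (if x k = y k ∧ z k = w k then 1 else 0) := by
  have hd0 : (d : ℂ) ≠ 0 := by norm_cast; omega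
  -- The contraction factors over sites: completeness gives the swap on `S`, and elsewhere the
  -- factor `d` cancels the weight `d⁻¹` of the identity.
  have hk : ∀ x y z w : Fin n → Fin d,
      (∏ k, if k ∈ S then (if x k = w k ∧ y k = z k then (1 : ℂ) else 0)
          else (if x k = y k ∧ z k = w k then 1 else 0)) =
      (d : ℂ) ^ (#Sᶜ) * ∑ j ∈ Fintype.piFinset fun k => if k ∈ S then univ else {none},
        ∏ k, (basisWeight d (j k) : ℂ) *
          (matrixBasis lam (j k) (x k) (y k) * matrixBasis lam (j k) (z k) (w k)) := by
    intro x y z w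
    rw [← Finset.prod_univ_sum (fun k => if k ∈ S then univ else {none}) fun k a =>
      (basisWeight d a : ℂ) * (matrixBasis lam a (x k) (y k) * matrixBasis lam a (z k) (w k))]
    have hp : (d : ℂ) ^ (#Sᶜ) = ∏ k, if k ∈ S then 1 else (d : ℂ) := by
      rw [Finset.prod_ite]
      simp [Finset.compl_eq_univ_sdiff, Finset.filter_notMem_eq_sdiff]
    rw [hp, ← Finset.prod_mul_distrib]
    refine Finset.prod_congr rfl fun k _ => ?_
    by_cases hkS : k ∈ S
    · simp only [hkS, if_true, one_mul, sum_basisWeight_mul hd hlam]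
    · simp only [hkS, if_false, Finset.sum_singleton, matrixBasis, basisWeight,
        Matrix.one_apply]
      push_cast
      rw [mul_inv_cancel_left₀ hd0]
      split_ifs <;> simp_all
  have hsq : ∀ j : Fin n → Option (Fin (d ^ 2 - 1)), (sectorWeight lam ρ j : ℂ) =
      ∑ x, ∑ y, ∑ z, ∑ w, ρ y x * ρ w z * ∏ k, (basisWeight d (j k) : ℂ) *
          (matrixBasis lam (j k) (x k) (y k) * matrixBasis lam (j k) (z k) (w k)) := by
    intro j
    have ht : (ρ * tensorMatrix fun k => matrixBasis lam (j k)).trace =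
        ∑ x, ∑ y, ρ y x * ∏ k, matrixBasis lam (j k) (x k) (y k) := by
      rw [Finset.sum_comm]
      simp [Matrix.trace, Matrix.mul_apply, tensorMatrix]
    rw [sectorWeight, Complex.ofReal_mul, Complex.ofReal_pow, ofReal_re_trace_mul hρ
      (tensorMatrix_isHermitian fun k => matrixBasis_isHermitian hlam (j k)), ht, sq]
    simp only [Finset.sum_mul, Finset.mul_sum, Finset.prod_mul_distrib, Complex.ofReal_prod]
    refine Finset.sum_congr rfl fun x _ => Finset.sum_congr rfl fun y _ =>
      Finset.sum_congr rfl fun z _ => Finset.sum_congr rfl fun w _ => by ring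
  simp only [hk, supportWeight, Complex.ofReal_sum, hsq, Finset.mul_sum]
  rw [Finset.sum_comm]
  refine Finset.sum_congr rfl fun x _ => ?_
  rw [Finset.sum_comm]
  refine Finset.sum_congr rfl fun y _ => ?_
  rw [Finset.sum_comm]
  refine Finset.sum_congr rfl fun z _ => ?_
  rw [Finset.sum_comm]
  refine Finset.sum_congr rfl fun w _ => Finset.sum_congr rfl fun j _ => by ring

/-- For a pure state, the purities of complementary subsystems agree. -/
theorem pow_mul_supportWeight_compl {n d : ℕ} (hd : 2 ≤ d)
    {lam : Fin (d ^ 2 - 1) → Matrix (Fin d) (Fin d) ℂ} (hlam : IsSUGenerators d lam)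
    (ψ : (Fin n → Fin d) → ℂ) (S : Finset (Fin n)) :
    (d : ℝ) ^ (#Sᶜ) * supportWeight lam (vecMulVec ψ (star ψ)) S =
      (d : ℝ) ^ (#S) * supportWeight lam (vecMulVec ψ (star ψ)) Sᶜ := by
  have hρ : (vecMulVec ψ (star ψ)).IsHermitian := (posSemidef_vecMulVec_self_star ψ).isHermitian
  have h1 := supportWeight_eq_sum hd hlam hρ S
  have h2 := supportWeight_eq_sum hd hlam hρ Sᶜ
  rw [compl_compl] at h2
  apply Complex.ofReal_injective
  push_cast
  rw [h1, h2]
  -- Exchanging `x` and `z` swaps the column indices of the two copies: this interchanges swaps with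
  -- identities at every site, while a product of two copies of a rank-one `ρ` is unchanged.
  have hc : ∀ f : (Fin n → Fin d) → (Fin n → Fin d) → (Fin n → Fin d) → (Fin n → Fin d) → ℂ,
      ∑ x, ∑ y, ∑ z, ∑ w, f x y z w = ∑ x, ∑ y, ∑ z, ∑ w, f z y x w := by
    intro f
    calc _ = ∑ x, ∑ z, ∑ y, ∑ w, f x y z w :=
          Finset.sum_congr rfl fun x _ => Finset.sum_comm
      _ = ∑ z, ∑ x, ∑ y, ∑ w, f x y z w := Finset.sum_comm
      _ = _ := Finset.sum_congr rfl fun x _ => Finset.sum_comm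
  rw [hc]
  refine Finset.sum_congr rfl fun x _ => Finset.sum_congr rfl fun y _ =>
      Finset.sum_congr rfl fun z _ => Finset.sum_congr rfl fun w _ => ?_
  congr 1
  · simp only [vecMulVec_apply]; ring
  · refine Finset.prod_congr rfl fun k _ => ?_
    by_cases hk : k ∈ S <;>
      simp only [hk, Finset.mem_compl, if_true, if_false, not_true, not_false_iff] <;>
      congr 1 <;> simp only [eq_comm, and_comm]

theorem supportWeight_empty {n d : ℕ} (lam : Fin (d ^ 2 - 1) → Matrix (Fin d) (Fin d) ℂ)
    (ρ : Matrix (Fin n → Fin d) (Fin n → Fin d) ℂ) :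
    supportWeight lam ρ ∅ = sectorWeight lam ρ fun _ => none := by
  simp [supportWeight]

theorem sectorWeight_none {n d : ℕ} (lam : Fin (d ^ 2 - 1) → Matrix (Fin d) (Fin d) ℂ)
    (ρ : Matrix (Fin n → Fin d) (Fin n → Fin d) ℂ) :
    sectorWeight lam ρ (fun _ => none) = ((d : ℝ) ^ n)⁻¹ * ρ.trace.re ^ 2 := by
  have h : (tensorMatrix fun _ : Fin n => (1 : Matrix (Fin d) (Fin d) ℂ)) = 1 := by
    ext x y
    simp [tensorMatrix, Matrix.one_apply, Finset.prod_ite_zero, funext_iff]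
  simp [sectorWeight, matrixBasis, basisWeight, h]

theorem norm_blochTensor_sq {n d : ℕ} (lam : Fin (d ^ 2 - 1) → Matrix (Fin d) (Fin d) ℂ)
    (ρ : Matrix (Fin n → Fin d) (Fin n → Fin d) ℂ) :
    ‖blochTensor lam ρ‖ ^ 2 =
      2 ^ n * ∑ j ∈ univ.filter fun j : Fin n → Option (Fin (d ^ 2 - 1)) => ∀ k, j k ≠ none,
        sectorWeight lam ρ j := by
  rw [EuclideanSpace.norm_sq_eq, Finset.mul_sum]
  refine Finset.sum_bij (fun i _ k => some (i k)) (by simp) ?_ ?_ ?_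
  · intro a _ b _ h
    ext1 k
    exact Option.some_injective _ (congrFun h k)
  · intro j hj
    simp only [Finset.mem_filter, Finset.mem_univ, true_and, Option.ne_none_iff_exists'] at hj
    choose i hi using hj
    exact ⟨i, Finset.mem_univ _, funext fun k => (hi k).symm⟩
  · intro i _
    simp [sectorWeight, basisWeight, matrixBasis, blochTensor]

/-! ### The counting inequality and the bound for pure states. -/

/-- A bound on the number of positions where `j` is `none`, with indicator terms for `j` having
full support, empty support, and support in a single position. -/
theorem support_count_le {n : ℕ} (hn : 3 ≤ n) {α : Type*} [DecidableEq α]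
    (j : Fin n → Option α) :
    ((n : ℝ) - 2) * (if ∀ k, j k ≠ none then 1 else 0) + ∑ i, (if j i = none then 1 else 0) ≤
      ((n : ℝ) - 2) * (1 - if j = (fun _ => none) then 1 else 0) +
        ∑ i, (if ∀ k, k ≠ i → j k = none then (1 : ℝ) else 0) := by
  have hn' : (3 : ℝ) ≤ n := by exact_mod_cast hn
  have hpos : 0 ≤ ∑ i, (if ∀ k, k ≠ i → j k = none then (1 : ℝ) else 0) :=
    Finset.sum_nonneg fun _ _ => by split_ifs <;> norm_num
  have hcard : ∑ i, (if j i = none then (1 : ℝ) else 0) =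
      n - ∑ i, (if j i = none then (0 : ℝ) else 1) := by
    rw [eq_sub_iff_add_eq, ← Finset.sum_add_distrib]
    calc _ = ∑ _i : Fin n, (1 : ℝ) := Finset.sum_congr rfl fun i _ => by split_ifs <;> norm_num
      _ = n := by simp
  by_cases h0 : j = fun _ => none
  · subst h0
    have h : ¬ ∀ k : Fin n, (fun _ => none : Fin n → Option α) k ≠ none :=
      fun h => h ⟨0, by omega⟩ rfl
    rw [if_neg h]
    simp
  have hne : ∃ a, j a ≠ none := by
    by_contra! h
    exact h0 (funext h)
  obtain ⟨a, ha⟩ := hne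
  simp only [h0, if_false, sub_zero, mul_one]
  by_cases hall : ∀ k, j k ≠ none
  · rw [if_pos hall, Finset.sum_eq_zero fun i _ => if_neg (hall i)]
    linarith
  rw [if_neg hall, hcard]
  by_cases hb : ∃ b, b ≠ a ∧ j b ≠ none
  · obtain ⟨b, hba, hb⟩ := hb
    have h2 : (2 : ℝ) ≤ ∑ i, (if j i = none then (0 : ℝ) else 1) := by
      calc (2 : ℝ) = ∑ i ∈ ({b, a} : Finset (Fin n)), (if j i = none then (0 : ℝ) else 1) := by
            rw [Finset.sum_pair hba, if_neg ha, if_neg hb]; norm_num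
        _ ≤ _ := Finset.sum_le_sum_of_subset_of_nonneg (Finset.subset_univ _)
            fun _ _ _ => by split_ifs <;> norm_num
    linarith
  · push Not at hb
    have h1 : (1 : ℝ) ≤ ∑ i, (if ∀ k, k ≠ i → j k = none then (1 : ℝ) else 0) := by
      calc (1 : ℝ) = if ∀ k, k ≠ a → j k = none then (1 : ℝ) else 0 := (if_pos hb).symm
        _ ≤ _ := Finset.single_le_sum
            (f := fun i => if ∀ k, k ≠ i → j k = none then (1 : ℝ) else 0)
            (fun _ _ => by split_ifs <;> norm_num) (Finset.mem_univ a)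
    have h2 : (1 : ℝ) ≤ ∑ i, (if j i = none then (0 : ℝ) else 1) := by
      calc (1 : ℝ) = if j a = none then (0 : ℝ) else 1 := (if_neg ha).symm
        _ ≤ _ := Finset.single_le_sum (f := fun i => if j i = none then (0 : ℝ) else 1)
            (fun _ _ => by split_ifs <;> norm_num) (Finset.mem_univ a)
    linarith

theorem supportWeight_eq_sum_ite {n d : ℕ} (lam : Fin (d ^ 2 - 1) → Matrix (Fin d) (Fin d) ℂ)
    (ρ : Matrix (Fin n → Fin d) (Fin n → Fin d) ℂ) (S : Finset (Fin n)) :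
    supportWeight lam ρ S =
      ∑ j, (if ∀ k, k ∉ S → j k = none then 1 else 0) * sectorWeight lam ρ j := by
  simp only [ite_mul, one_mul, zero_mul]
  rw [← Finset.sum_filter, supportWeight]
  congr 1
  ext j
  simp only [Fintype.mem_piFinset, Finset.mem_filter, Finset.mem_univ, true_and]
  refine forall_congr' fun k => ?_
  by_cases hk : k ∈ S <;> simp [hk]

/-- The vector is not normalized; the factor `trace ^ 2` makes the bound homogeneous, so it applies
directly to the rank-one summands of a mixed state. -/
theorem blochTensor_vecMulVec_le {n d : ℕ} (hn : 3 ≤ n) (hd : 2 ≤ d)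
    {lam : Fin (d ^ 2 - 1) → Matrix (Fin d) (Fin d) ℂ} (hlam : IsSUGenerators d lam)
    (ψ : (Fin n → Fin d) → ℂ) :
    ‖blochTensor lam (vecMulVec ψ (star ψ))‖ ^ 2 ≤
      2 ^ n * (((n : ℝ) - 2) * (d : ℝ) ^ n - (n : ℝ) * (d : ℝ) ^ (n - 2) + 2) /
        (((n : ℝ) - 2) * (d : ℝ) ^ n) * (vecMulVec ψ (star ψ)).trace.re ^ 2 := by
  set ρ := vecMulVec ψ (star ψ) with hρ
  set t := ρ.trace.re
  set g := sectorWeight lam ρ with hg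
  have hn' : (3 : ℝ) ≤ n := by exact_mod_cast hn
  have hd' : (2 : ℝ) ≤ d := by exact_mod_cast hd
  have hg0 : ∀ j, 0 ≤ g j := sectorWeight_nonneg lam ρ
  have hnone : g (fun _ => none) = ((d : ℝ) ^ n)⁻¹ * t ^ 2 := sectorWeight_none lam ρ
  have hdn : 0 < (d : ℝ) ^ n := by positivity
  have htot : ∑ j, g j = t ^ 2 := by
    have h := pow_mul_supportWeight_compl hd hlam ψ univ
    rw [Finset.compl_univ, ← hρ, supportWeight_empty, ← hg, hnone] at h
    simp only [Finset.card_empty, Finset.card_univ, Fintype.card_fin, pow_zero, one_mul] at h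
    rw [mul_inv_cancel_left₀ hdn.ne', supportWeight_eq_sum_ite] at h
    simpa using h
  have hsingle : ∀ i : Fin n, ∑ j, (if j i = none then 1 else 0) * g j =
      (d : ℝ) ^ (n - 2) * ∑ j, (if ∀ k, k ≠ i → j k = none then 1 else 0) * g j := by
    intro i
    have h := pow_mul_supportWeight_compl hd hlam ψ {i}
    rw [← hρ, supportWeight_eq_sum_ite, supportWeight_eq_sum_ite, Finset.card_compl] at h
    simp only [Finset.card_singleton, Fintype.card_fin, Finset.mem_compl, Finset.mem_singleton,
      not_not, forall_eq] at h
    rw [show n - 1 = n - 2 + 1 by omega, pow_succ, mul_comm _ (d : ℝ), mul_assoc, pow_one] at h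
    exact (mul_left_cancel₀ (by positivity) h).symm
  set F := ∑ j ∈ univ.filter fun j : Fin n → Option (Fin (d ^ 2 - 1)) => ∀ k, j k ≠ none, g j
    with hF
  have hF' : F = ∑ j, (if ∀ k, j k ≠ none then 1 else 0) * g j := by
    simp only [ite_mul, one_mul, zero_mul]
    rw [← Finset.sum_filter]
  set W := ∑ i, ∑ j : Fin n → Option (Fin (d ^ 2 - 1)),
    (if ∀ k, k ≠ i → j k = none then 1 else 0) * g j with hW
  -- The empty sector is supported in every `{i}`, so it is counted `n` times in `W`.
  have hWge : n * g (fun _ => none) ≤ W := by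
    calc n * g (fun _ => none) = ∑ _i : Fin n, g (fun _ => none) := by simp
      _ ≤ W := Finset.sum_le_sum fun i _ => by
        calc g (fun _ => none) = (if ∀ k, k ≠ i → (fun _ => none : Fin n →
                Option (Fin (d ^ 2 - 1))) k = none then 1 else 0) * g (fun _ => none) := by simp
          _ ≤ _ := Finset.single_le_sum (f := fun j : Fin n → Option (Fin (d ^ 2 - 1)) =>
                (if ∀ k, k ≠ i → j k = none then 1 else 0) * g j)
              (fun j _ => mul_nonneg (by split_ifs <;> norm_num) (hg0 j)) (Finset.mem_univ _)
  have hmain : ((n : ℝ) - 2) * F + (d : ℝ) ^ (n - 2) * W ≤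
      ((n : ℝ) - 2) * (t ^ 2 - g fun _ => none) + W := by
    -- Weight the counting inequality by `g j` and sum over `j`; `hsingle` turns the count of
    -- `none`s into `d ^ (n - 2) * W`.
    have h := Finset.sum_le_sum fun (j : Fin n → Option (Fin (d ^ 2 - 1))) (_ : j ∈ univ) =>
      mul_le_mul_of_nonneg_right (support_count_le hn j) (hg0 j)
    simp only [add_mul, Finset.sum_add_distrib, Finset.sum_mul, mul_assoc,
      ← Finset.mul_sum, sub_mul, one_mul, Finset.sum_sub_distrib] at h
    rw [← hF', Finset.sum_comm (s := univ (α := Fin n → Option (Fin (d ^ 2 - 1)))),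
      Finset.sum_comm (s := univ (α := Fin n → Option (Fin (d ^ 2 - 1)))),
      Finset.sum_congr rfl fun i _ => hsingle i, ← Finset.mul_sum, htot] at h
    simp only [ite_mul, one_mul, zero_mul, Finset.sum_ite_eq',
      Finset.mem_univ, if_true] at h hW ⊢
    rw [← hW] at h
    linarith
  -- The net coefficient `d ^ (n - 2) - 1` of `W` is nonnegative, so `W` may be replaced by its
  -- lower bound.
  have hpow : (1 : ℝ) ≤ (d : ℝ) ^ (n - 2) := one_le_pow₀ (by linarith)
  have hle : ((n : ℝ) - 2) * F ≤ ((n : ℝ) - 2) * (t ^ 2 - ((d : ℝ) ^ n)⁻¹ * t ^ 2) -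
      ((d : ℝ) ^ (n - 2) - 1) * (n * (((d : ℝ) ^ n)⁻¹ * t ^ 2)) := by
    rw [hnone] at hmain hWge
    have := mul_le_mul_of_nonneg_left hWge (sub_nonneg.mpr hpow)
    linarith
  rw [norm_blochTensor_sq, ← hg, ← hF, mul_div_assoc, mul_assoc]
  refine mul_le_mul_of_nonneg_left ?_ (by positivity)
  have hn2 : 0 < (n : ℝ) - 2 := by linarith
  rw [div_mul_eq_mul_div, le_div_iff₀ (by positivity)]
  calc F * (((n : ℝ) - 2) * (d : ℝ) ^ n) = ((n : ℝ) - 2) * F * (d : ℝ) ^ n := by ring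
    _ ≤ _ := mul_le_mul_of_nonneg_right hle hdn.le
    _ = _ := by field_simp; ring

/-! ### Extension to mixed states. -/

theorem blochTensor_sum {n d : ℕ} (lam : Fin (d ^ 2 - 1) → Matrix (Fin d) (Fin d) ℂ)
    {ι : Type*} (s : Finset ι) (ρ : ι → Matrix (Fin n → Fin d) (Fin n → Fin d) ℂ) :
    blochTensor lam (∑ i ∈ s, ρ i) = ∑ i ∈ s, blochTensor lam (ρ i) := by
  ext j
  simp [blochTensor, Finset.sum_mul, Matrix.trace_sum]

theorem corollary1 (n d : ℕ) (hn : 3 ≤ n) (hd : 2 ≤ d)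
    (lam : Fin (d ^ 2 - 1) → Matrix (Fin d) (Fin d) ℂ) (hlam : IsSUGenerators d lam)
    (ρ : Matrix (Fin n → Fin d) (Fin n → Fin d) ℂ) (hρ : IsDensityMatrix ρ) :
    ‖blochTensor lam ρ‖ ^ 2 ≤
      2 ^ n * (((n : ℝ) - 2) * (d : ℝ) ^ n - (n : ℝ) * (d : ℝ) ^ (n - 2) + 2) /
        (((n : ℝ) - 2) * (d : ℝ) ^ n) := by
  obtain ⟨m, v, hv⟩ := Matrix.posSemidef_iff_eq_sum_vecMulVec.mp hρ.posSemidef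
  set B : ℝ := 2 ^ n * (((n : ℝ) - 2) * (d : ℝ) ^ n - (n : ℝ) * (d : ℝ) ^ (n - 2) + 2) /
        (((n : ℝ) - 2) * (d : ℝ) ^ n)
  -- The pure-state bound at a product basis vector, of trace one, shows that `B` is at least a
  -- square.
  have hB : 0 ≤ B := by
    have h := (sq_nonneg _).trans
      (blochTensor_vecMulVec_le hn hd hlam (Pi.single (fun _ => ⟨0, by omega⟩) 1))
    simpa [Matrix.trace_vecMulVec] using h
  have hpure : ∀ i, ‖blochTensor lam (vecMulVec (v i) (star (v i)))‖ ≤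
      √B * (vecMulVec (v i) (star (v i))).trace.re := by
    intro i
    have ht : 0 ≤ (vecMulVec (v i) (star (v i))).trace.re :=
      (Complex.nonneg_iff.mp (posSemidef_vecMulVec_self_star (v i)).trace_nonneg).1
    refine le_of_sq_le_sq ?_ (by positivity)
    rw [mul_pow, Real.sq_sqrt hB]
    exact blochTensor_vecMulVec_le hn hd hlam (v i)
  have htr : ∑ i, (vecMulVec (v i) (star (v i))).trace.re = 1 := by
    rw [← Complex.re_sum, ← Matrix.trace_sum, ← hv, hρ.trace_eq_one, Complex.one_re]
  have hnorm : ‖blochTensor lam ρ‖ ≤ √B := by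
    calc ‖blochTensor lam ρ‖ ≤ ∑ i, ‖blochTensor lam (vecMulVec (v i) (star (v i)))‖ := by
          rw [hv, blochTensor_sum]; exact norm_sum_le _ _
      _ ≤ ∑ i, √B * (vecMulVec (v i) (star (v i))).trace.re :=
          Finset.sum_le_sum fun i _ => hpure i
      _ = √B := by rw [← Finset.mul_sum, htr, mul_one]
  calc ‖blochTensor lam ρ‖ ^ 2 ≤ √B ^ 2 := by gcongr
    _ = B := Real.sq_sqrt hB
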